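/- Let $X$ be an infinite-dimensional real Banach space with topological dual $X^*$. A nonempty norm-bounded set $E\subset X^*$ is called remotal from $x^*\in X^*$ if there is $e_0\in E$ with $\|x^*-e_0\|=\sup\{\|x^*-e\|:e\in E\}$, and remotal if it is remotal from every point of $X^*$. Then there exists a nonempty (norm-bounded) weak$^*$-compact convex set $K\subset X^*$ that is not remotal. More precisely, there exists a sequence $(x_n^*)_{n\ge 1}$ of unit vectors of $X^*$ with $x_n^*\to 0$ in the weak$^*$ topology, and for every such sequence the weak$^*$-closed convex hull $K$ of $$\Bigl\{\tfrac{n}{n+1}\,x_n^* : n\ge 1\Bigr\}\cup\{0\}$$ is a norm-bounded weak$^*$-compact convex set that is not remotal from $0$; in particular, $K$ is not remotal. -/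

import Mathlib

open Filter Topology

/-- `D(x, E) = sup {‖x - e‖ : e ∈ E}`, for a nonempty bounded set `E` of a normed space. -/
noncomputable def farthestDist {V : Type*} [NormedAddCommGroup V] (x : V) (E : Set V) : ℝ :=
  sSup ((fun e => ‖x - e‖) '' E)

/-- The bounded set `E` is remotal from `x`: it has a farthest point from `x`. -/
def IsRemotalFrom {V : Type*} [NormedAddCommGroup V] (E : Set V) (x : V) : Prop :=
  ∃ e₀ ∈ E, farthestDist x E = ‖x - e₀‖

/-- The bounded set `E` is remotal: it is remotal from every point of the space. -/
def IsRemotal {V : Type*} [NormedAddCommGroup V] (E : Set V) : Prop :=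
  ∀ x : V, IsRemotalFrom E x

/-- `x` is a weak*-null sequence of unit vectors of the dual of `X`. -/
def IsWeakStarNullUnit {X : Type*} [NormedAddCommGroup X] [NormedSpace ℝ X]
    (x : ℕ → StrongDual ℝ X) : Prop :=
  (∀ n, ‖x n‖ = 1) ∧ Tendsto (fun n => StrongDual.toWeakDual (x n)) atTop (𝓝 0)

/-- The set `{n / (n + 1) · x_n : n ≥ 1} ∪ {0}`. -/
def scaledSet {X : Type*} [NormedAddCommGroup X] [NormedSpace ℝ X]
    (x : ℕ → StrongDual ℝ X) : Set (StrongDual ℝ X) :=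
  {y | ∃ n : ℕ, 1 ≤ n ∧ y = ((n : ℝ) / ((n : ℝ) + 1)) • x n} ∪ {0}

/-- The weak*-closed convex hull of a set `E` in the dual of `X`, as a subset of the dual
with its weak* topology. -/
def weakStarClosedConvexHull {X : Type*} [NormedAddCommGroup X] [NormedSpace ℝ X]
    (E : Set (StrongDual ℝ X)) : Set (WeakDual ℝ X) :=
  closedConvexHull ℝ (StrongDual.toWeakDual '' E)

/-! Non-remotality: suppose an element of the hull `K` has norm at least 1. The generators with
index at most `N` lie in a ball of radius `N/(N+1) < 1`, so this element can put no weight on them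
and lies in the weak*-closed hull of every tail. The generators are weak*-null, so it vanishes at
every point, a contradiction. Hence all norms in `K` are below 1, while the generators have norms
tending to 1, and no point of `K` is farthest from 0.

Existence of the sequence is the Josefson–Nissenzweig theorem. Normalizing reduces it to finding
pointwise null functionals with norms bounded below. Start from a bounded 1-separated sequence in
the dual. Either a subsequence converges weak*, and consecutive differences work, or a weak* cluster
point outside the closed span yields a sequence whose initial segments and tails have uniformly
separated convex hulls. In the second case, pass to convex blocks whose asymptotic oscillation `δ`
no further blocking changes. If `δ = 0`, the blocks are pointwise Cauchy and differences of
far-apart blocks work. If `δ > 0`, stability makes finitely many block sequences oscillate at one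
common point. Repeated splitting gives a dyadic tree of functionals, and its Rademacher averages are
square-summable at each point, hence null, yet have norm at least `δ/4`. -/

/-! ### Convex block sequences and diagonalization -/

section Blocks

variable {V : Type*} [AddCommGroup V] [Module ℝ V]

/-- `g` is eventually made of convex combinations of arbitrarily late terms of `f`. -/
def IsConvexBlock (g f : ℕ → V) : Prop :=
  ∀ N, ∀ᶠ k in atTop, g k ∈ convexHull ℝ (f '' Set.Ici N)

theorem IsConvexBlock.refl (f : ℕ → V) : IsConvexBlock f f := fun N => by
  filter_upwards [eventually_ge_atTop N] with k hk
  exact subset_convexHull ℝ _ ⟨k, hk, rfl⟩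

theorem IsConvexBlock.comp {g f : ℕ → V} (h : IsConvexBlock g f) {u : ℕ → ℕ}
    (hu : Tendsto u atTop atTop) : IsConvexBlock (g ∘ u) f :=
  fun N => hu.eventually (h N)

theorem IsConvexBlock.trans {h g f : ℕ → V} (hg : IsConvexBlock h g) (gf : IsConvexBlock g f) :
    IsConvexBlock h f := fun N => by
  obtain ⟨M, hM⟩ := eventually_atTop.1 (gf N)
  filter_upwards [hg M] with k hk
  refine convexHull_min ?_ (convex_convexHull ℝ _) hk
  rintro _ ⟨m, hm, rfl⟩
  exact hM m hm

theorem IsConvexBlock.sum {ι : Type*} (s : Finset ι) (w : ι → ℝ) (hw : ∀ i ∈ s, 0 ≤ w i)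
    (hw1 : ∑ i ∈ s, w i = 1) {h : ι → ℕ → V} {f : ℕ → V}
    (hf : ∀ i ∈ s, IsConvexBlock (h i) f) :
    IsConvexBlock (fun k => ∑ i ∈ s, w i • h i k) f := fun N => by
  have := (Finset.eventually_all s).2 fun i hi => hf i hi N
  filter_upwards [this] with k hk
  exact (convex_convexHull ℝ _).sum_mem hw hw1 hk

theorem isConvexBlock_of_le {F : ℕ → ℕ → V} (hF : ∀ j, IsConvexBlock (F (j + 1)) (F j))
    {i j : ℕ} (hij : i ≤ j) : IsConvexBlock (F j) (F i) := by
  induction j, hij using Nat.le_induction with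
  | base => exact .refl _
  | succ j _ ih => exact (hF j).trans ih

/-- A decreasing sequence of convex block sequences has a diagonal lower bound. -/
theorem exists_isConvexBlock_diagonal {F : ℕ → ℕ → V}
    (hF : ∀ j, IsConvexBlock (F (j + 1)) (F j)) : ∃ g, ∀ j, IsConvexBlock g (F j) := by
  -- The diagonal term is taken so late in `F k` that it lies in the `k`-th tail hull of every
  -- earlier sequence at once.
  have key : ∀ k, ∃ m, ∀ i ∈ Finset.range (k + 1),
      F k m ∈ convexHull ℝ (F i '' Set.Ici k) := fun k =>
    ((Finset.eventually_all _).2 fun i hi =>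
      isConvexBlock_of_le hF (Nat.lt_succ_iff.1 (Finset.mem_range.1 hi)) k).exists
  choose m hm using key
  refine ⟨fun k => F k (m k), fun j N => ?_⟩
  filter_upwards [eventually_ge_atTop (max j N)] with k hk
  refine convexHull_mono (Set.image_mono (Set.Ici_subset_Ici.2 (le_of_max_le_right hk)))
    (hm k j (Finset.mem_range.2 ?_))
  have := le_of_max_le_left hk
  omega

end Blocks

/-! ### Asymptotic oscillation and its stabilization -/

section Oscillation

variable {X : Type*} [NormedAddCommGroup X] [NormedSpace ℝ X]

/-- Asymptotic upper bounds for the oscillation of `f` at the points of the unit ball. -/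
def oscBounds (f : ℕ → StrongDual ℝ X) : Set ℝ :=
  {δ | ∀ x : X, ‖x‖ ≤ 1 → ∃ N, ∀ m n, N ≤ m → N ≤ n → f m x - f n x ≤ δ}

/-- The supremum over the unit ball of the asymptotic oscillation of `f`. -/
noncomputable def asympOsc (f : ℕ → StrongDual ℝ X) : ℝ := sInf (oscBounds f)

theorem nonneg_of_mem_oscBounds {f : ℕ → StrongDual ℝ X} {δ : ℝ} (h : δ ∈ oscBounds f) :
    0 ≤ δ := by
  obtain ⟨N, hN⟩ := h 0 (by simp)
  simpa using hN N N le_rfl le_rfl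

theorem bddBelow_oscBounds (f : ℕ → StrongDual ℝ X) : BddBelow (oscBounds f) :=
  ⟨0, fun _ h => nonneg_of_mem_oscBounds h⟩

theorem asympOsc_nonneg (f : ℕ → StrongDual ℝ X) : 0 ≤ asympOsc f :=
  Real.sInf_nonneg fun _ h => nonneg_of_mem_oscBounds h

theorem apply_le_norm_of_unit {f : StrongDual ℝ X} {R : ℝ} (hf : ‖f‖ ≤ R) {x : X}
    (hx : ‖x‖ ≤ 1) : |f x| ≤ R := by
  have h := f.le_opNorm x
  rw [Real.norm_eq_abs] at h
  nlinarith [norm_nonneg f, norm_nonneg x]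

theorem oscBounds_nonempty {f : ℕ → StrongDual ℝ X} {R : ℝ} (hf : ∀ n, ‖f n‖ ≤ R) :
    (oscBounds f).Nonempty := by
  refine ⟨2 * R, fun x hx => ⟨0, fun m n _ _ => ?_⟩⟩
  have h1 := abs_le.1 (apply_le_norm_of_unit (hf m) hx)
  have h2 := abs_le.1 (apply_le_norm_of_unit (hf n) hx)
  linarith

theorem mem_oscBounds_of_lt {f : ℕ → StrongDual ℝ X} (hf : (oscBounds f).Nonempty) {δ : ℝ}
    (h : asympOsc f < δ) : δ ∈ oscBounds f := by
  obtain ⟨d, hd, hdδ⟩ := exists_lt_of_csInf_lt hf h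
  intro x hx
  obtain ⟨N, hN⟩ := hd x hx
  exact ⟨N, fun m n hm hn => (hN m n hm hn).trans hdδ.le⟩

theorem convex_apply_sub_le (x : X) (S : Set (StrongDual ℝ X)) {δ : ℝ}
    (h : ∀ a ∈ S, ∀ b ∈ S, a x - b x ≤ δ) :
    ∀ a ∈ convexHull ℝ S, ∀ b ∈ convexHull ℝ S, a x - b x ≤ δ := by
  have hle : ∀ c : ℝ, Convex ℝ {a : StrongDual ℝ X | a x ≤ c} := fun c =>
    convex_halfSpace_le (f := fun a : StrongDual ℝ X => a x)
      ⟨fun _ _ => rfl, fun _ _ => rfl⟩ c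
  have hge : ∀ c : ℝ, Convex ℝ {a : StrongDual ℝ X | c ≤ a x} := fun c =>
    convex_halfSpace_ge (f := fun a : StrongDual ℝ X => a x)
      ⟨fun _ _ => rfl, fun _ _ => rfl⟩ c
  have h1 : ∀ b ∈ S, ∀ a ∈ convexHull ℝ S, a x ≤ δ + b x := fun b hb a ha =>
    convexHull_min (fun c hc => by have := h c hc b hb; simp only [Set.mem_ofPred_eq]; linarith)
      (hle _) ha
  intro a ha b hb
  have : a x - δ ≤ b x :=
    convexHull_min (fun c hc => by have := h1 c hc a ha; simp only [Set.mem_ofPred_eq]; linarith)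
      (hge (a x - δ)) hb
  linarith

theorem IsConvexBlock.oscBounds_subset {g f : ℕ → StrongDual ℝ X} (h : IsConvexBlock g f) :
    oscBounds f ⊆ oscBounds g := by
  intro δ hδ x hx
  obtain ⟨N, hN⟩ := hδ x hx
  obtain ⟨M, hM⟩ := eventually_atTop.1 (h N)
  refine ⟨M, fun m n hm hn => convex_apply_sub_le x _ ?_ _ (hM m hm) _ (hM n hn)⟩
  rintro _ ⟨i, hi, rfl⟩ _ ⟨j, hj, rfl⟩
  exact hN i j hi hj

theorem IsConvexBlock.asympOsc_le {g f : ℕ → StrongDual ℝ X} (h : IsConvexBlock g f)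
    (hf : (oscBounds f).Nonempty) : asympOsc g ≤ asympOsc f :=
  csInf_le_csInf (bddBelow_oscBounds g) hf h.oscBounds_subset

/-- Every bounded sequence has a convex block sequence whose oscillation does not decrease
under further blocking. -/
theorem exists_isConvexBlock_stable {f : ℕ → StrongDual ℝ X} {R : ℝ} (hf : ∀ n, ‖f n‖ ≤ R) :
    ∃ g, IsConvexBlock g f ∧ (∀ n, ‖g n‖ ≤ R) ∧
      ∀ h, IsConvexBlock h g → asympOsc h = asympOsc g := by
  have hne := oscBounds_nonempty hf
  -- Stage `j` nearly minimizes the oscillation over all blocks, so a diagonal lower bound attains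
  -- the minimum among its own blocks.
  have step : ∀ (j : ℕ) (p : {g // IsConvexBlock g f}), ∃ q : {g // IsConvexBlock g f},
      IsConvexBlock q.1 p.1 ∧
      ∀ h, IsConvexBlock h p.1 → asympOsc q.1 ≤ asympOsc h + 1 / ((j : ℝ) + 1) := by
    rintro j ⟨p, hp⟩
    set I : Set ℝ := asympOsc '' {h | IsConvexBlock h p}
    have hI : BddBelow I := ⟨0, by rintro _ ⟨h, _, rfl⟩; exact asympOsc_nonneg h⟩
    have hIne : I.Nonempty := ⟨_, p, .refl p, rfl⟩
    obtain ⟨_, ⟨q, hq, rfl⟩, hlt⟩ := exists_lt_of_csInf_lt hIne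
      (lt_add_of_pos_right (sInf I) (Nat.one_div_pos_of_nat (α := ℝ) (n := j)))
    refine ⟨⟨q, hq.trans hp⟩, hq, fun h hh => hlt.le.trans ?_⟩
    gcongr
    exact csInf_le hI ⟨h, hh, rfl⟩
  choose! next hnext hosc using step
  let F : ℕ → {g // IsConvexBlock g f} := fun n => Nat.rec ⟨f, .refl f⟩ next n
  obtain ⟨g, hg⟩ := exists_isConvexBlock_diagonal (F := fun j => (F j).1)
    fun j => hnext j (F j)
  have hgf : IsConvexBlock g f := hg 0
  have stable : ∀ h, IsConvexBlock h g → asympOsc g ≤ asympOsc h := by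
    intro h hh
    refine le_of_forall_pos_le_add fun ε hε => ?_
    obtain ⟨j, hj⟩ := exists_nat_one_div_lt hε
    have h1 := hosc j (F j) h (hh.trans (hg j))
    have h2 := (hg (j + 1)).asympOsc_le (hne.mono (F (j + 1)).2.oscBounds_subset)
    change asympOsc g ≤ asympOsc (next j (F j)).1 at h2
    linarith
  -- Blocks are only eventually in the hull of `f`; dropping the first `M` terms gives the norm
  -- bound for every index.
  obtain ⟨M, hM⟩ := eventually_atTop.1 (hgf 0)
  have hsh : IsConvexBlock (g ∘ (· + M)) g := (IsConvexBlock.refl g).comp (tendsto_add_atTop_nat M)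
  have hgne : (oscBounds g).Nonempty := hne.mono hgf.oscBounds_subset
  refine ⟨g ∘ (· + M), hsh.trans hgf, fun n => ?_, fun h hh => ?_⟩
  · have : g (n + M) ∈ Metric.closedBall (0 : StrongDual ℝ X) R := by
      refine convexHull_min ?_ (convex_closedBall _ _) (hM (n + M) (by omega))
      rintro _ ⟨i, -, rfl⟩
      simpa using hf i
    simpa using this
  · exact le_antisymm (hh.asympOsc_le (hgne.mono hsh.oscBounds_subset))
      ((hsh.asympOsc_le hgne).trans (stable h (hh.trans hsh)))

end Oscillation

/-! ### Weak* convergence versus hull separation -/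

section Selection

variable {X : Type*} [NormedAddCommGroup X] [NormedSpace ℝ X]

/-- A separable set of functionals has a countable family of points at which nonzero members
do not all vanish. -/
theorem exists_seq_separating_of_isSeparable {Y : Set (StrongDual ℝ X)}
    (hY : TopologicalSpace.IsSeparable Y) :
    ∃ d : ℕ → X, ∀ y ∈ Y, (∀ n, y (d n) = 0) → y = 0 := by
  obtain ⟨c, hc, hYc⟩ := hY
  obtain ⟨e, he⟩ := (hc.insert 0).exists_eq_range (Set.insert_nonempty _ _)
  -- Points half-norming a countable dense family separate: if `y` vanishes at them, an approximant
  -- within `ε/3` has norm at most `2ε/3`.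
  have key : ∀ f : StrongDual ℝ X, ∃ x : X, ‖x‖ ≤ 1 ∧ ‖f‖ ≤ 2 * ‖f x‖ := fun f => by
    rcases eq_or_ne f 0 with rfl | hf
    · exact ⟨0, by simp⟩
    · obtain ⟨x, hx, hfx⟩ := f.exists_lt_apply_of_lt_opNorm
        (half_lt_self (norm_pos_iff.2 hf))
      exact ⟨x, hx.le, by linarith⟩
  choose p hp hp2 using key
  refine ⟨fun n => p (e n), fun y hy h0 => ?_⟩
  rw [← norm_le_zero_iff]
  refine le_of_forall_pos_le_add fun ε hε => ?_
  obtain ⟨z, hz, hyz⟩ := Metric.mem_closure_iff.1 (hYc hy) (ε / 3) (by positivity)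
  rw [dist_eq_norm] at hyz
  obtain ⟨n, rfl⟩ : z ∈ Set.range e := he ▸ Set.mem_insert_of_mem _ hz
  have h1 : ‖(y - e n) (p (e n))‖ ≤ ‖y - e n‖ :=
    ((y - e n).le_opNorm _).trans (mul_le_of_le_one_right (norm_nonneg _) (hp _))
  rw [sub_apply, h0 n, zero_sub, norm_neg] at h1
  have h2 := norm_sub_norm_le y (e n)
  have h3 := hp2 (e n)
  linarith

/-- A bounded sequence of functionals has a subsequence converging at countably many points. -/
theorem exists_subseq_tendsto_apply {f : ℕ → StrongDual ℝ X} {R : ℝ} (hf : ∀ n, ‖f n‖ ≤ R)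
    (d : ℕ → X) : ∃ u : ℕ → ℕ, StrictMono u ∧
      ∀ j, ∃ l, Tendsto (fun n => f (u n) (d j)) atTop (𝓝 l) := by
  have hc : IsCompact (Set.univ.pi fun j => Metric.closedBall (0 : ℝ) (R * ‖d j‖)) :=
    isCompact_univ_pi fun j => isCompact_closedBall _ _
  obtain ⟨a, -, u, hu, ha⟩ := hc.tendsto_subseq (x := fun n j => f n (d j)) fun n j _ => by
    rw [mem_closedBall_zero_iff]
    exact ((f n).le_opNorm _).trans (by gcongr; exact hf n)
  exact ⟨u, hu, fun j => ⟨a j, (tendsto_pi_nhds.1 ha) j⟩⟩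

/-- On the common kernel of finitely many functionals, a functional has norm at least its
distance from their span. -/
theorem exists_apply_gt_of_dist_span {s : Finset (StrongDual ℝ X)} {f : StrongDual ℝ X} {θ : ℝ}
    (h : ∀ g ∈ Submodule.span ℝ (s : Set (StrongDual ℝ X)), θ < ‖f - g‖) :
    ∃ x : X, ‖x‖ ≤ 1 ∧ (∀ g ∈ s, g x = 0) ∧ θ < f x := by
  let p : Submodule ℝ X := ⨅ g : s, LinearMap.ker (g.1 : X →ₗ[ℝ] ℝ)
  have hp : ∀ x ∈ p, ∀ g ∈ s, g x = 0 := fun x hx g hg => by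
    simpa using (Submodule.mem_iInf _).1 hx ⟨g, hg⟩
  -- For a norm-preserving Hahn–Banach extension `F` of `f` restricted to `p`, the difference `f -
  -- F` kills `p`, so it lies in the span and `‖F‖ > θ`.
  obtain ⟨F, hF, hFn⟩ := exists_extension_norm_eq p (f.comp p.subtypeL)
  have hker : p ≤ LinearMap.ker ((f - F : StrongDual ℝ X) : X →ₗ[ℝ] ℝ) := fun x hx => by
    have := hF ⟨x, hx⟩
    simp only [ContinuousLinearMap.comp_apply, Submodule.subtypeL_apply] at this
    simp [this]
  have hspan := mem_span_of_iInf_ker_le_ker hker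
  have hmem : f - F ∈ Submodule.span ℝ (s : Set (StrongDual ℝ X)) := by
    obtain ⟨c, hc⟩ := (Submodule.mem_span_range_iff_exists_fun ℝ).1 hspan
    have : f - F = ∑ g : s, c g • g.1 := by
      ext x
      have := congrArg (fun L : X →ₗ[ℝ] ℝ => L x) hc
      simp only [LinearMap.sum_apply, LinearMap.smul_apply, ContinuousLinearMap.coe_coe] at this
      rw [← this]
      simp
    rw [this]
    exact Submodule.sum_mem _ fun g _ => Submodule.smul_mem _ _ (Submodule.subset_span g.2)
  have hθ := h _ hmem
  rw [sub_sub_cancel, hFn] at hθ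
  rcases lt_or_ge θ 0 with hneg | hpos
  · exact ⟨0, by simp, by simp, by simpa using hneg⟩
  obtain ⟨x, hx, hlt⟩ := (f.comp p.subtypeL).exists_lt_apply_of_lt_opNorm hθ
  have hlt' : θ < |f x| := by simpa using hlt
  rcases lt_abs.1 hlt' with h1 | h1
  · exact ⟨x, hx.le, hp x x.2, h1⟩
  · exact ⟨-x, by simpa using hx.le, fun g hg => by simp [hp x x.2 g hg], by simpa using h1⟩

/-- The tails of `f` are uniformly norm separated from its initial segments,
even after taking convex hulls. -/
def HullSeparated (f : ℕ → StrongDual ℝ X) (θ : ℝ) : Prop :=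
  ∀ k, ∀ a ∈ convexHull ℝ (f '' Set.Iio k), ∀ b ∈ convexHull ℝ (f '' Set.Ici k), θ ≤ ‖a - b‖

/-- There is a pointwise null sequence of functionals with norms bounded away from zero. -/
def HasSeminormalizedNull (X : Type*) [NormedAddCommGroup X] [NormedSpace ℝ X] : Prop :=
  ∃ (φ : ℕ → StrongDual ℝ X) (c : ℝ), 0 < c ∧ (∀ n, c ≤ ‖φ n‖) ∧
    ∀ x, Tendsto (fun n => φ n x) atTop (𝓝 0)

/-- Each chosen functional comes with a test point that kills it and all earlier choices but at
which `F` is large. Later choices approximate `F` there, so this point separates the hulls. -/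
theorem exists_hullSeparated_of_mapClusterPt {f : ℕ → StrongDual ℝ X}
    {Y : Submodule ℝ (StrongDual ℝ X)}
    (hY : IsClosed (Y : Set (StrongDual ℝ X))) (hf : ∀ n, f n ∈ Y) {F : StrongDual ℝ X}
    (hF : F ∉ Y) (hc : MapClusterPt (StrongDual.toWeakDual F) atTop
      fun n => StrongDual.toWeakDual (f n)) :
    ∃ (h : ℕ → StrongDual ℝ X) (θ : ℝ), 0 < θ ∧ (∀ n, h n ∈ Set.range f) ∧
      HullSeparated h θ := by
  obtain ⟨ε, hε, hball⟩ := Metric.isOpen_iff.1 hY.isOpen_compl F hF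
  have hd : ∀ g ∈ Y, ε / 2 < ‖F - g‖ := fun g hg => by
    by_contra! hle
    refine hball (?_ : g ∈ Metric.ball F ε) hg
    rw [Metric.mem_ball, dist_comm, dist_eq_norm]
    linarith
  -- Pick the functional first, near `F` at the old test points, then a new test point annihilated
  -- by all functionals so far.
  obtain ⟨q, hq, hqr⟩ := exists_seq_of_forall_finset_exists
    (fun q : StrongDual ℝ X × X => q.1 ∈ Set.range f ∧ ‖q.2‖ ≤ 1 ∧ ε / 2 < F q.2 ∧ q.1 q.2 = 0)
    (fun q r => ε / 4 < r.1 q.2 ∧ q.1 r.2 = 0) fun s hs => by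
      classical
      have hev : ∀ᶠ g : WeakDual ℝ X in 𝓝 (StrongDual.toWeakDual F), ∀ q ∈ s, ε / 4 < g q.2 :=
        (Finset.eventually_all _).2 fun q hq =>
          (WeakDual.eval_continuous q.2).continuousAt.eventually
            (lt_mem_nhds (by have := (hs q hq).2.2.1; change _ < F q.2; linarith))
      obtain ⟨n, hn⟩ := (hc.frequently hev).exists
      obtain ⟨x, hx, hx0, hFx⟩ := exists_apply_gt_of_dist_span (f := F) (θ := ε / 2)
        (s := insert (f n) (s.image Prod.fst)) fun g hg => hd g (by
          refine Submodule.span_le.2 ?_ hg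
          intro g hg
          rcases Finset.mem_insert.1 hg with rfl | hg
          · exact hf n
          · obtain ⟨q, hq, rfl⟩ := Finset.mem_image.1 hg
            obtain ⟨m, hm⟩ := (hs q hq).1
            exact hm ▸ hf m)
      exact ⟨(f n, x), ⟨⟨n, rfl⟩, hx, hFx, hx0 _ (Finset.mem_insert_self _ _)⟩, fun q hq =>
        ⟨hn q hq, hx0 _ (Finset.mem_insert_of_mem (Finset.mem_image_of_mem _ hq))⟩⟩
  refine ⟨fun n => (q n).1, ε / 4, by positivity, fun n => (hq n).1, fun k a ha b hb => ?_⟩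
  rcases k with _ | k
  · simp at ha
  have ha0 : a (q k).2 ≤ 0 := by
    refine convexHull_min ?_ (convex_halfSpace_le
      (f := fun a : StrongDual ℝ X => a (q k).2) ⟨fun _ _ => rfl, fun _ _ => rfl⟩ 0) ha
    rintro _ ⟨i, hi, rfl⟩
    rcases (Nat.lt_succ_iff.1 hi).eq_or_lt with rfl | hlt
    · exact (hq i).2.2.2.le
    · exact (hqr i k hlt).2.le
  have hb0 : ε / 4 ≤ b (q k).2 := by
    refine convexHull_min ?_ (convex_halfSpace_ge
      (f := fun a : StrongDual ℝ X => a (q k).2) ⟨fun _ _ => rfl, fun _ _ => rfl⟩ _) hb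
    rintro _ ⟨i, hi, rfl⟩
    exact (hqr k i hi).1.le
  have h1 := abs_le.1 (apply_le_norm_of_unit (le_refl ‖a - b‖) (hq k).2.1)
  rw [sub_apply] at h1
  linarith

theorem not_finiteDimensional_strongDual (hX : ¬ FiniteDimensional ℝ X) :
    ¬ FiniteDimensional ℝ (StrongDual ℝ X) := fun h => hX <| by
  have : FiniteDimensional ℝ (StrongDual ℝ (StrongDual ℝ X)) := inferInstance
  exact FiniteDimensional.of_injective
    ((NormedSpace.inclusionInDoubleDualLi ℝ : X →ₗᵢ[ℝ] _).toLinearMap)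
    (NormedSpace.inclusionInDoubleDualLi ℝ : X →ₗᵢ[ℝ] _).injective

/-- The subsequence converges at countably many points separating the closed span `Y`. Cluster
points inside `Y` must therefore coincide, and a cluster point outside `Y` gives hull separation. -/
theorem hasSeminormalizedNull_or_exists_hullSeparated (hX : ¬ FiniteDimensional ℝ X) :
    HasSeminormalizedNull X ∨ ∃ (h : ℕ → StrongDual ℝ X) (R θ : ℝ), 0 < θ ∧
      (∀ n, ‖h n‖ ≤ R) ∧ HullSeparated h θ := by
  obtain ⟨R, f₀, -, hf₀, hsep₀⟩ :=
    exists_seq_norm_le_one_le_norm_sub (not_finiteDimensional_strongDual hX)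
  set Y : Submodule ℝ (StrongDual ℝ X) := (Submodule.span ℝ (Set.range f₀)).topologicalClosure
  have hYsep : TopologicalSpace.IsSeparable (Y : Set (StrongDual ℝ X)) := by
    rw [Submodule.topologicalClosure_coe]
    exact ((Set.countable_range f₀).isSeparable.span (R := ℝ)).closure
  obtain ⟨d, hd⟩ := exists_seq_separating_of_isSeparable hYsep
  obtain ⟨u, hu, hlim⟩ := exists_subseq_tendsto_apply hf₀ d
  set f := f₀ ∘ u
  have hfY : ∀ n, f n ∈ Y := fun n =>
    Submodule.le_topologicalClosure _ (Submodule.subset_span ⟨u n, rfl⟩)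
  by_cases hA : ∀ F : StrongDual ℝ X, MapClusterPt (StrongDual.toWeakDual F) atTop
      (fun n => StrongDual.toWeakDual (f n)) → F ∈ Y
  · left
    have hcomp := WeakDual.isCompact_closedBall (0 : StrongDual ℝ X) R
    have hmem : ∀ n, StrongDual.toWeakDual (f n) ∈
        WeakDual.toStrongDual ⁻¹' Metric.closedBall (0 : StrongDual ℝ X) R := fun n =>
      mem_closedBall_zero_iff.2 (hf₀ (u n))
    have hval : ∀ G : WeakDual ℝ X, MapClusterPt G atTop
        (fun n => StrongDual.toWeakDual (f n)) → ∀ j l,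
        Tendsto (fun n => f n (d j)) atTop (𝓝 l) → G (d j) = l := by
      intro G hG j l hl
      have h1 : MapClusterPt (G (d j)) atTop fun n => f n (d j) :=
        hG.continuousAt_comp (WeakDual.eval_continuous (d j)).continuousAt
      exact eq_of_nhds_neBot (h1.neBot.mono (inf_le_inf_left _ hl))
    obtain ⟨F, -, hF⟩ := hcomp.exists_mapClusterPt (f := atTop)
      (u := fun n => StrongDual.toWeakDual (f n)) (tendsto_principal.2 (Eventually.of_forall hmem))
    have hconv : Tendsto (fun n => StrongDual.toWeakDual (f n)) atTop (𝓝 F) := by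
      refine hcomp.tendsto_nhds_of_unique_mapClusterPt (Eventually.of_forall hmem)
        fun G _ hG => ?_
      have := hd (WeakDual.toStrongDual G - WeakDual.toStrongDual F)
        (Y.sub_mem (hA _ hG) (hA _ hF)) fun j => by
          obtain ⟨l, hl⟩ := hlim j
          rw [sub_apply]
          exact sub_eq_zero.2 ((hval G hG j l hl).trans (hval F hF j l hl).symm)
      exact sub_eq_zero.1 this
    refine ⟨fun n => f (n + 1) - f n, 1, one_pos, fun n => hsep₀ ?_, fun x => ?_⟩
    · exact fun h => absurd (hu.injective h) (by omega)
    · have hx : Tendsto (fun n => f n x) atTop (𝓝 (F x)) :=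
        ((WeakDual.eval_continuous x).tendsto F).comp hconv
      simpa using (hx.comp (tendsto_add_atTop_nat 1)).sub hx
  · right
    push Not at hA
    obtain ⟨F, hF, hFY⟩ := hA
    obtain ⟨h, θ, hθ, hr, hs⟩ := exists_hullSeparated_of_mapClusterPt
      (Submodule.isClosed_topologicalClosure _) hfY hFY hF
    refine ⟨h, R, θ, hθ, fun n => ?_, hs⟩
    obtain ⟨m, hm⟩ := hr n
    exact hm ▸ hf₀ (u m)

end Selection

/-! ### Rademacher functions on finite sets -/

section Rademacher

/-- The `j`-th Rademacher function on the finite sets of natural numbers. -/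
def rademacherSign (j : ℕ) (S : Finset ℕ) : ℝ := if j ∈ S then 1 else -1

theorem rademacherSign_mul_self (j : ℕ) (S : Finset ℕ) :
    rademacherSign j S * rademacherSign j S = 1 := by
  unfold rademacherSign; split_ifs <;> norm_num

theorem rademacherSign_symmDiff_self (j : ℕ) (S : Finset ℕ) :
    rademacherSign j (symmDiff S {j}) = -rademacherSign j S := by
  by_cases h : j ∈ S <;> simp [rademacherSign, Finset.mem_symmDiff, h]

theorem rademacherSign_symmDiff_of_ne {i j : ℕ} (hij : i ≠ j) (S : Finset ℕ) :
    rademacherSign i (symmDiff S {j}) = rademacherSign i S := by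
  by_cases h : i ∈ S <;> simp [rademacherSign, Finset.mem_symmDiff, h, hij]

theorem sum_powerset_symmDiff {N j : ℕ} (hj : j < N) (t : Finset ℕ → ℝ) :
    ∑ S ∈ (Finset.range N).powerset, t (symmDiff S {j}) =
      ∑ S ∈ (Finset.range N).powerset, t S := by
  have hmem : ∀ S ∈ (Finset.range N).powerset, symmDiff S {j} ∈ (Finset.range N).powerset := by
    intro S hS
    rw [Finset.mem_powerset] at hS ⊢
    intro i hi
    rcases Finset.mem_symmDiff.1 hi with h | h
    · exact hS h.1
    · rw [Finset.mem_singleton.1 h.1]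
      exact Finset.mem_range.2 hj
  exact Finset.sum_nbij' (fun S => symmDiff S {j}) (fun S => symmDiff S {j}) hmem hmem
    (fun S _ => symmDiff_symmDiff_cancel_right _ _)
    (fun S _ => symmDiff_symmDiff_cancel_right _ _) (fun _ _ => rfl)

theorem sum_rademacherSign_mul {N i j : ℕ} (hj : j < N) :
    ∑ S ∈ (Finset.range N).powerset, rademacherSign i S * rademacherSign j S =
      if i = j then 2 ^ N else 0 := by
  split_ifs with h
  · subst h
    simp [rademacherSign_mul_self]
  · have := sum_powerset_symmDiff hj fun S => rademacherSign i S * rademacherSign j S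
    simp only [rademacherSign_symmDiff_self, rademacherSign_symmDiff_of_ne h, mul_neg,
      Finset.sum_neg_distrib] at this
    linarith

/-- Bessel's inequality for the Rademacher functions. -/
theorem sum_sq_rademacher_coeff_le (N : ℕ) {t : Finset ℕ → ℝ} {M : ℝ} (ht : ∀ S, |t S| ≤ M) :
    ∑ j ∈ Finset.range N,
      ((2 ^ N)⁻¹ * ∑ S ∈ (Finset.range N).powerset, rademacherSign j S * t S) ^ 2 ≤ M ^ 2 := by
  set P := (Finset.range N).powerset
  set c : ℕ → ℝ := fun j => (2 ^ N)⁻¹ * ∑ S ∈ P, rademacherSign j S * t S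
  have hpos : (0 : ℝ) < 2 ^ N := by positivity
  have hc : ∀ j, ∑ S ∈ P, rademacherSign j S * t S = 2 ^ N * c j := fun j => by
    simp only [c]
    field_simp
  -- Expand the squared distance from `t` to its Rademacher projection; orthogonality evaluates the
  -- last two terms.
  have h0 : 0 ≤ ∑ S ∈ P, (t S - ∑ j ∈ Finset.range N, c j * rademacherSign j S) ^ 2 :=
    Finset.sum_nonneg fun _ _ => sq_nonneg _
  have hcross : ∑ S ∈ P, t S * ∑ j ∈ Finset.range N, c j * rademacherSign j S =
      2 ^ N * ∑ j ∈ Finset.range N, c j ^ 2 := by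
    simp_rw [Finset.mul_sum]
    rw [Finset.sum_comm]
    refine Finset.sum_congr rfl fun j _ => ?_
    calc _ = c j * ∑ S ∈ P, rademacherSign j S * t S := by
          rw [Finset.mul_sum]; exact Finset.sum_congr rfl fun _ _ => by ring
      _ = _ := by rw [hc]; ring
  have hsq : ∑ S ∈ P, (∑ j ∈ Finset.range N, c j * rademacherSign j S) ^ 2 =
      2 ^ N * ∑ j ∈ Finset.range N, c j ^ 2 := by
    simp_rw [sq, Finset.sum_mul_sum]
    rw [Finset.sum_comm, Finset.mul_sum]
    refine Finset.sum_congr rfl fun i hi => ?_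
    rw [Finset.sum_comm]
    calc _ = ∑ j ∈ Finset.range N, c i * c j * ∑ S ∈ P, rademacherSign i S * rademacherSign j S := by
          refine Finset.sum_congr rfl fun j _ => ?_
          rw [Finset.mul_sum]; exact Finset.sum_congr rfl fun _ _ => by ring
      _ = ∑ j ∈ Finset.range N, if i = j then 2 ^ N * (c i * c j) else 0 := by
          refine Finset.sum_congr rfl fun j hj => ?_
          rw [sum_rademacherSign_mul (Finset.mem_range.1 hj)]
          split_ifs <;> ring
      _ = _ := by rw [Finset.sum_ite_eq, if_pos hi]
  have htM : ∑ S ∈ P, t S ^ 2 ≤ 2 ^ N * M ^ 2 := by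
    have : ∑ S ∈ P, t S ^ 2 ≤ ∑ _S ∈ P, M ^ 2 :=
      Finset.sum_le_sum fun S _ => sq_le_sq' (abs_le.1 (ht S)).1 (abs_le.1 (ht S)).2
    simpa [P] using this
  have hexp : ∑ S ∈ P, (t S - ∑ j ∈ Finset.range N, c j * rademacherSign j S) ^ 2 =
      ∑ S ∈ P, t S ^ 2 - 2 * ∑ S ∈ P, t S * ∑ j ∈ Finset.range N, c j * rademacherSign j S +
      ∑ S ∈ P, (∑ j ∈ Finset.range N, c j * rademacherSign j S) ^ 2 := by
    rw [Finset.mul_sum, ← Finset.sum_sub_distrib, ← Finset.sum_add_distrib]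
    exact Finset.sum_congr rfl fun _ _ => by ring
  rw [hexp, hcross, hsq] at h0
  refine le_of_mul_le_mul_left ?_ hpos
  linarith

/-- Pairing `S` with `symmDiff S {j}` gives at least `δ` per pair; summing over all `S` counts each
pair twice, hence the factor 1/2. -/
theorem le_rademacher_coeff {N j : ℕ} (hj : j < N) {t : Finset ℕ → ℝ} {δ : ℝ}
    (h : ∀ S, j ∉ S → δ ≤ t (insert j S) - t S) :
    δ / 2 ≤ (2 ^ N)⁻¹ * ∑ S ∈ (Finset.range N).powerset, rademacherSign j S * t S := by
  have hpos : (0 : ℝ) < 2 ^ N := by positivity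
  have hflip := sum_powerset_symmDiff hj fun S => rademacherSign j S * t S
  have hterm : ∀ S, δ ≤ rademacherSign j S * t S +
      rademacherSign j (symmDiff S {j}) * t (symmDiff S {j}) := by
    intro S
    rw [rademacherSign_symmDiff_self]
    by_cases hS : j ∈ S
    · have e : symmDiff S {j} = S.erase j := by
        ext i; by_cases hi : i = j <;> simp [Finset.mem_symmDiff, hi, hS]
      have := h (S.erase j) (Finset.notMem_erase j S)
      rw [Finset.insert_erase hS] at this
      simp only [e, rademacherSign, hS, if_true]
      linarith
    · have e : symmDiff S {j} = insert j S := by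
        ext i; by_cases hi : i = j <;> simp [Finset.mem_symmDiff, hi, hS]
      have := h S hS
      simp only [e, rademacherSign, hS, if_false]
      linarith
  have hsum : 2 ^ N * δ ≤ ∑ S ∈ (Finset.range N).powerset, (rademacherSign j S * t S +
      rademacherSign j (symmDiff S {j}) * t (symmDiff S {j})) := by
    have := Finset.card_nsmul_le_sum (Finset.range N).powerset _ δ fun S _ => hterm S
    simpa using this
  rw [Finset.sum_add_distrib, hflip] at hsum
  rw [le_inv_mul_iff₀ hpos]
  linarith

end Rademacher

/-! ### The Josefson–Nissenzweig theorem -/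

section Null

variable {X : Type*} [NormedAddCommGroup X] [NormedSpace ℝ X]

theorem exists_mem_convexHull_image_Iio {V : Type*} [AddCommGroup V] [Module ℝ V]
    {f : ℕ → V} {a : V} {s : Set ℕ} (ha : a ∈ convexHull ℝ (f '' s)) :
    ∃ m, a ∈ convexHull ℝ (f '' Set.Iio m) := by
  have hmono : ∀ {m n : ℕ}, m ≤ n →
      convexHull ℝ (f '' Set.Iio m) ⊆ convexHull ℝ (f '' Set.Iio n) := fun h =>
    convexHull_mono (Set.image_mono (Set.Iio_subset_Iio h))
  refine convexHull_min (t := {a | ∃ m, a ∈ convexHull ℝ (f '' Set.Iio m)}) ?_ ?_ ha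
  · rintro _ ⟨i, -, rfl⟩
    exact ⟨i + 1, subset_convexHull ℝ _ ⟨i, Nat.lt_succ_self i, rfl⟩⟩
  · rintro a ⟨m, hm⟩ b ⟨n, hn⟩ p q hp hq hpq
    exact ⟨max m n, convex_convexHull ℝ _ (hmono (le_max_left _ _) hm)
      (hmono (le_max_right _ _) hn) hp hq hpq⟩

/-- A block involves finitely many terms of `f`, so a sufficiently late block is at distance at
least `θ` from it; zero oscillation makes such differences pointwise null. -/
theorem hasSeminormalizedNull_of_asympOsc_eq_zero {f g : ℕ → StrongDual ℝ X} {θ : ℝ}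
    (hθ : 0 < θ) (hs : HullSeparated f θ) (hgf : IsConvexBlock g f)
    (hne : (oscBounds g).Nonempty) (h0 : asympOsc g = 0) : HasSeminormalizedNull X := by
  obtain ⟨M, hM⟩ := eventually_atTop.1 (hgf 0)
  have key : ∀ k, ∃ l, k ≤ l ∧ θ ≤ ‖g (k + M) - g l‖ := fun k => by
    obtain ⟨m, hm⟩ := exists_mem_convexHull_image_Iio (hM (k + M) (by omega))
    obtain ⟨l, hl, hkl⟩ := ((hgf m).and (eventually_ge_atTop k)).exists
    exact ⟨l, hkl, hs m _ hm _ hl⟩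
  choose l hkl hl using key
  refine ⟨fun k => g (k + M) - g (l k), θ, hθ, hl, fun x => ?_⟩
  rw [Metric.tendsto_atTop]
  intro ε hε
  have hx : 0 < ‖x‖ + 1 := by positivity
  have hδ : 0 < ε / 2 / (‖x‖ + 1) := by positivity
  have hunit : ‖(‖x‖ + 1)⁻¹ • x‖ ≤ 1 := by
    rw [norm_smul, Real.norm_of_nonneg (by positivity), inv_mul_le_iff₀ hx]
    linarith
  obtain ⟨N, hN⟩ := mem_oscBounds_of_lt hne (h0.trans_lt hδ) _ hunit
  refine ⟨N, fun k hk => ?_⟩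
  have hbd : ∀ m n, N ≤ m → N ≤ n → g m x - g n x ≤ ε / 2 := fun m n hm hn => by
    have := hN m n hm hn
    simp only [map_smul, smul_eq_mul, ← mul_sub] at this
    rwa [inv_mul_le_iff₀ hx, mul_div_cancel₀ _ hx.ne'] at this
  have h1 := hbd (k + M) (l k) (by omega) (hk.trans (hkl k))
  have h2 := hbd (l k) (k + M) (hk.trans (hkl k)) (by omega)
  rw [Real.dist_eq, sub_zero, sub_apply]
  refine (abs_le.2 ⟨?_, h1⟩).trans_lt (half_lt_self hε)
  linarith

/-- If blocking does not decrease the oscillation of `g`, then finitely many block sequences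
of `g` oscillate simultaneously at a common point. -/
theorem exists_common_oscillation {g : ℕ → StrongDual ℝ X} {R : ℝ} (hpos : 0 < asympOsc g)
    (hstable : ∀ h, IsConvexBlock h g → asympOsc h = asympOsc g)
    {ι : Type*} [Fintype ι] [Nonempty ι] {h : ι → ℕ → StrongDual ℝ X}
    (hh : ∀ i, IsConvexBlock (h i) g) (hhR : ∀ i n, ‖h i n‖ ≤ R) :
    ∃ (x : X) (u v : ℕ → ℕ), ‖x‖ ≤ 1 ∧ Tendsto u atTop atTop ∧ Tendsto v atTop atTop ∧
      ∀ i k l, asympOsc g / 2 ≤ h i (u k) x - h i (v l) x := by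
  classical
  set δ := asympOsc g
  set n : ℝ := (Fintype.card ι : ℝ)
  have hn : 0 < n := by simpa [n] using Fintype.card_pos (α := ι)
  -- The average oscillates by more than `δ - ε` and each member by at most `δ + ε`, so each member
  -- retains `n(δ - ε) - (n - 1)(δ + ε) ≥ δ - 2nε = 3δ/4`.
  set ε := δ / (8 * n)
  have hε : 0 < ε := by positivity
  have hnε : n * ε = δ / 8 := by simp only [ε]; field_simp
  set a : ℕ → StrongDual ℝ X := fun k => ∑ i : ι, n⁻¹ • h i k
  have ha : IsConvexBlock a g := IsConvexBlock.sum Finset.univ (fun _ => n⁻¹)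
    (fun _ _ => by positivity) (by simp [n]) fun i _ => hh i
  have hout : δ - ε ∉ oscBounds a := fun hin => by
    have h1 := csInf_le (bddBelow_oscBounds a) hin
    change asympOsc a ≤ _ at h1
    rw [hstable a ha] at h1
    change δ ≤ δ - ε at h1
    linarith
  simp only [oscBounds, Set.mem_ofPred_eq, not_forall, not_exists, not_le] at hout
  obtain ⟨x, hx, hosc⟩ := hout
  have hbd : ∀ i, ∃ N, ∀ p q, N ≤ p → N ≤ q → h i p x - h i q x ≤ δ + ε := fun i =>
    mem_oscBounds_of_lt (oscBounds_nonempty (hhR i))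
      (by rw [hstable _ (hh i)]; linarith) x hx
  choose N hN using hbd
  have hpairs : ∀ j, ∃ p q, j ≤ p ∧ j ≤ q ∧ ∀ i, 3 * δ / 4 ≤ h i p x - h i q x := fun j => by
    obtain ⟨p, q, hp, hq, hpq⟩ := hosc (max j (Finset.univ.sup N))
    refine ⟨p, q, le_of_max_le_left hp, le_of_max_le_left hq, fun i => ?_⟩
    have hNle : ∀ i, N i ≤ Finset.univ.sup N := fun i => Finset.le_sup (Finset.mem_univ i)
    have hsum : n * (δ - ε) < ∑ i, (h i p x - h i q x) := by
      have e : a p x - a q x = n⁻¹ * ∑ i, (h i p x - h i q x) := by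
        simp only [a, sum_apply, smul_apply, smul_eq_mul,
          ← Finset.mul_sum, Finset.sum_sub_distrib, mul_sub]
      rw [e, lt_inv_mul_iff₀ hn] at hpq
      exact hpq
    have hrest : ∑ k ∈ Finset.univ.erase i, (h k p x - h k q x) ≤ (n - 1) * (δ + ε) := by
      have := Finset.sum_le_card_nsmul (Finset.univ.erase i) (fun k => h k p x - h k q x) (δ + ε)
        fun k _ => hN k p q ((hNle k).trans (le_of_max_le_right hp))
          ((hNle k).trans (le_of_max_le_right hq))
      rw [nsmul_eq_mul, Finset.card_erase_of_mem (Finset.mem_univ i), Finset.card_univ,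
        Nat.cast_sub Fintype.card_pos, Nat.cast_one] at this
      exact this
    rw [← Finset.add_sum_erase _ _ (Finset.mem_univ i)] at hsum
    nlinarith
  choose p q hp hq hpq using hpairs
  have hc : IsCompact (Set.univ.pi fun _ : ι =>
      Metric.closedBall (0 : ℝ) R ×ˢ Metric.closedBall (0 : ℝ) R) :=
    isCompact_univ_pi fun _ => (isCompact_closedBall _ _).prod (isCompact_closedBall _ _)
  -- Making the values at `x` converge decouples the two indices: replacing `v k` by `v l` costs at
  -- most `δ/8`, leaving more than `δ/2`.
  obtain ⟨z, -, w, hw, hz⟩ := hc.tendsto_subseq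
    (x := fun j i => (h i (p j) x, h i (q j) x)) fun j i _ =>
      ⟨mem_closedBall_zero_iff.2 (apply_le_norm_of_unit (hhR i _) hx),
        mem_closedBall_zero_iff.2 (apply_le_norm_of_unit (hhR i _) hx)⟩
  have hz' := tendsto_pi_nhds.1 hz
  have hev : ∀ᶠ j in atTop, ∀ i, |h i (p (w j)) x - (z i).1| < δ / 16 ∧
      |h i (q (w j)) x - (z i).2| < δ / 16 := eventually_all.2 fun i => by
    have h1 := (continuous_fst.tendsto _).comp (hz' i)
    have h2 := (continuous_snd.tendsto _).comp (hz' i)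
    exact (h1.eventually (Metric.ball_mem_nhds _ (by positivity : 0 < δ / 16))).and
      (h2.eventually (Metric.ball_mem_nhds _ (by positivity : 0 < δ / 16)))
  obtain ⟨J, hJ⟩ := eventually_atTop.1 hev
  have hshift : Tendsto (fun k => w (k + J)) atTop atTop :=
    hw.tendsto_atTop.comp (tendsto_add_atTop_nat J)
  refine ⟨x, fun k => p (w (k + J)), fun k => q (w (k + J)), hx,
    (tendsto_atTop_mono hp tendsto_id).comp hshift,
    (tendsto_atTop_mono hq tendsto_id).comp hshift, fun i k l => ?_⟩
  have h1 := abs_lt.1 (hJ (k + J) (by omega) i).1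
  have h2 := abs_lt.1 (hJ (l + J) (by omega) i).2
  have h3 := abs_lt.1 (hJ (k + J) (by omega) i).2
  have h4 := hpq (w (k + J)) i
  linarith

/-- A dyadic tree of subsequences of `g`: stage `n` splits every branch at one common point `x n`,
taking the high half when `n ∈ S` and the low half otherwise. -/
theorem exists_rademacher_like {g : ℕ → StrongDual ℝ X} {R : ℝ}
    (hR : ∀ n, ‖g n‖ ≤ R) (hpos : 0 < asympOsc g)
    (hstable : ∀ h, IsConvexBlock h g → asympOsc h = asympOsc g) :
    ∃ x : ℕ → X, (∀ n, ‖x n‖ ≤ 1) ∧ ∀ N, ∃ ψ : Finset ℕ → StrongDual ℝ X,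
      (∀ S, ‖ψ S‖ ≤ R) ∧
      ∀ j < N, ∀ S, j ∉ S → asympOsc g / 2 ≤ ψ (insert j S) (x j) - ψ S (x j) := by
  classical
  let State := {H : Finset ℕ → ℕ → StrongDual ℝ X //
    (∀ S, IsConvexBlock (H S) g) ∧ ∀ S k, ‖H S k‖ ≤ R}
  have step : ∀ (n : ℕ) (H : State), ∃ (x : X) (u v : ℕ → ℕ), ‖x‖ ≤ 1 ∧
      Tendsto u atTop atTop ∧ Tendsto v atTop atTop ∧
      ∀ S ∈ (Finset.range n).powerset, ∀ k l,
        asympOsc g / 2 ≤ H.1 S (u k) x - H.1 S (v l) x := by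
    rintro n ⟨H, hH, hHR⟩
    have : Nonempty ((Finset.range n).powerset) := ⟨⟨∅, by simp⟩⟩
    obtain ⟨x, u, v, hx, hu, hv, h⟩ := exists_common_oscillation hpos hstable
      (h := fun S : (Finset.range n).powerset => H S) (fun S => hH S) (fun S => hHR S)
    exact ⟨x, u, v, hx, hu, hv, fun S hS => h ⟨S, hS⟩⟩
  choose x u v hx hu hv hsplit using step
  let next : ℕ → State → State := fun n H =>
    ⟨fun S => H.1 S ∘ (if n ∈ S then u n H else v n H), fun S => by
      dsimp only
      split_ifs
      · exact (H.2.1 S).comp (hu n H)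
      · exact (H.2.1 S).comp (hv n H), fun S k => H.2.2 S _⟩
  let H : ℕ → State := fun n =>
    Nat.rec ⟨fun _ => g, fun _ => .refl g, fun _ => hR⟩ next n
  have hsucc : ∀ n S, (H (n + 1)).1 S =
      (H n).1 S ∘ (if n ∈ S then u n (H n) else v n (H n)) := fun _ _ => rfl
  have hdep : ∀ n S T, (∀ i < n, i ∈ S ↔ i ∈ T) → (H n).1 S = (H n).1 T := by
    intro n
    induction n with
    | zero => exact fun _ _ _ => rfl
    | succ n ih =>
      intro S T hST
      rw [hsucc, hsucc, ih S T fun i hi => hST i (by omega)]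
      simp only [hST n (by omega)]
  have hnest : ∀ m n, m ≤ n → ∀ S k, ∃ l, (H n).1 S k = (H m).1 S l := by
    intro m n hmn
    induction n, hmn using Nat.le_induction with
    | base => exact fun S k => ⟨k, rfl⟩
    | succ n _ ih =>
      intro S k
      rw [hsucc]
      exact ih S _
  -- The index 0 is arbitrary: the gap at stage `j` holds for all pairs of indices, so it survives
  -- later subsequences.
  refine ⟨fun n => x n (H n), fun n => hx n (H n), fun N =>
    ⟨fun S => (H N).1 S 0, fun S => (H N).2.2 S 0, fun j hj S hS => ?_⟩⟩
  obtain ⟨k, hk⟩ := hnest (j + 1) N hj (insert j S) 0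
  obtain ⟨l, hl⟩ := hnest (j + 1) N hj S 0
  have hbase : ∀ T, (∀ i < j, i ∈ T ↔ i ∈ S) →
      (H j).1 T = (H j).1 (S ∩ Finset.range j) := fun T hT => hdep j _ _ fun i hi => by
    simp [hT i hi, hi]
  have h1 := hbase (insert j S) fun i hi => by simp [hi.ne]
  have h2 := hbase S fun i _ => Iff.rfl
  dsimp only
  rw [hk, hl, hsucc, hsucc, h1, h2]
  simp only [Finset.mem_insert_self, if_true, hS, if_false, Function.comp_apply]
  exact hsplit j (H j) _ (Finset.mem_powerset.2 Finset.inter_subset_right) _ _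

/-- Take `φ j` to be the `j`-th Rademacher coefficient of `S ↦ ψ S`; Bessel's inequality at each `y`
bounds the square sum independently of `N`. -/
theorem exists_bessel_functionals {g : ℕ → StrongDual ℝ X} {R : ℝ}
    (hR : ∀ n, ‖g n‖ ≤ R) (hpos : 0 < asympOsc g)
    (hstable : ∀ h, IsConvexBlock h g → asympOsc h = asympOsc g) :
    ∃ x : ℕ → X, (∀ n, ‖x n‖ ≤ 1) ∧ ∀ N, ∃ φ : ℕ → StrongDual ℝ X,
      (∀ j, ‖φ j‖ ≤ R) ∧ (∀ j < N, asympOsc g / 4 ≤ φ j (x j)) ∧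
      ∀ y, ∑ j ∈ Finset.range N, (φ j y) ^ 2 ≤ (R * ‖y‖) ^ 2 := by
  obtain ⟨x, hx, h⟩ := exists_rademacher_like hR hpos hstable
  refine ⟨x, hx, fun N => ?_⟩
  obtain ⟨ψ, hψR, hψ⟩ := h N
  have happ : ∀ j y, ((2 ^ N : ℝ)⁻¹ • ∑ S ∈ (Finset.range N).powerset,
      rademacherSign j S • ψ S) y = (2 ^ N : ℝ)⁻¹ *
        ∑ S ∈ (Finset.range N).powerset, rademacherSign j S * ψ S y := fun j y => by
    simp
  refine ⟨fun j => (2 ^ N : ℝ)⁻¹ • ∑ S ∈ (Finset.range N).powerset, rademacherSign j S • ψ S,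
    fun j => ?_, fun j hj => ?_, fun y => ?_⟩
  · rw [norm_smul, Real.norm_of_nonneg (by positivity), inv_mul_le_iff₀ (by positivity)]
    have hterm : ∀ S ∈ (Finset.range N).powerset, ‖rademacherSign j S • ψ S‖ ≤ R := fun S _ => by
      have : ‖rademacherSign j S‖ = 1 := by unfold rademacherSign; split_ifs <;> simp
      rw [norm_smul, this, one_mul]
      exact hψR S
    simpa using norm_sum_le_of_le _ hterm
  · rw [happ]
    have := le_rademacher_coeff hj (t := fun S => ψ S (x j)) (hψ j hj)
    linarith
  · simp only [happ]
    refine sum_sq_rademacher_coeff_le N fun S => ?_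
    exact ((ψ S).le_opNorm y).trans (by gcongr; exact hψR S)

theorem hasSeminormalizedNull_of_asympOsc_pos {g : ℕ → StrongDual ℝ X} {R : ℝ}
    (hR : ∀ n, ‖g n‖ ≤ R) (hpos : 0 < asympOsc g)
    (hstable : ∀ h, IsConvexBlock h g → asympOsc h = asympOsc g) :
    HasSeminormalizedNull X := by
  obtain ⟨x, hx, h⟩ := exists_bessel_functionals hR hpos hstable
  choose Φ hΦR hΦx hΦ using h
  -- The functionals depend on `N`; an ultrafilter gives weak* limits as `N → ∞` for all `j` without
  -- sequential compactness.
  let U : Ultrafilter ℕ := hyperfilter ℕ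
  have hU : (U : Filter ℕ) ≤ atTop := Nat.hyperfilter_le_atTop
  have hlim : ∀ j, ∃ G : StrongDual ℝ X, ∀ y, Tendsto (fun N => Φ N j y) U (𝓝 (G y)) := by
    intro j
    obtain ⟨G, -, hG⟩ := (WeakDual.isCompact_closedBall (0 : StrongDual ℝ X) R).ultrafilter_le_nhds
      (U.map fun N => StrongDual.toWeakDual (Φ N j)) (tendsto_principal.2 (Eventually.of_forall
        fun N => mem_closedBall_zero_iff.2 (hΦR N j)))
    exact ⟨WeakDual.toStrongDual G, fun y =>
      ((WeakDual.eval_continuous y).tendsto G).comp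
        (show Tendsto (fun N => StrongDual.toWeakDual (Φ N j)) U (𝓝 G) from hG)⟩
  choose G hG using hlim
  refine ⟨G, asympOsc g / 4, by positivity, fun j => ?_, fun y => ?_⟩
  · have h1 : asympOsc g / 4 ≤ G j (x j) := ge_of_tendsto (hG j (x j))
      (hU (by filter_upwards [eventually_gt_atTop j] with N hN using hΦx N j hN))
    exact h1.trans ((le_abs_self _).trans (apply_le_norm_of_unit le_rfl (hx j)))
  · have hsum : ∀ M, ∑ j ∈ Finset.range M, (G j y) ^ 2 ≤ (R * ‖y‖) ^ 2 := fun M => by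
      refine le_of_tendsto (tendsto_finsetSum _ fun j _ => (hG j y).pow 2) (hU ?_)
      filter_upwards [eventually_ge_atTop M] with N hN
      exact (Finset.sum_le_sum_of_subset_of_nonneg (Finset.range_mono hN)
        fun _ _ _ => sq_nonneg _).trans (hΦ N y)
    have hsq := (summable_of_sum_range_le (fun _ => sq_nonneg _) hsum).tendsto_atTop_zero
    have := (Real.continuous_sqrt.tendsto 0).comp hsq
    simp only [Real.sqrt_zero, Function.comp_def, Real.sqrt_sq_eq_abs] at this
    exact (tendsto_zero_iff_abs_tendsto_zero _).2 this

theorem hasSeminormalizedNull (hX : ¬ FiniteDimensional ℝ X) : HasSeminormalizedNull X := by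
  rcases hasSeminormalizedNull_or_exists_hullSeparated hX with h | ⟨f, R, θ, hθ, hR, hs⟩
  · exact h
  obtain ⟨g, hgf, hgR, hstable⟩ := exists_isConvexBlock_stable hR
  rcases (asympOsc_nonneg g).eq_or_lt with h0 | hpos
  · exact hasSeminormalizedNull_of_asympOsc_eq_zero hθ hs hgf (oscBounds_nonempty hgR) h0.symm
  · exact hasSeminormalizedNull_of_asympOsc_pos hgR hpos hstable

/-- The **Josefson–Nissenzweig theorem**. -/
theorem exists_isWeakStarNullUnit (hX : ¬ FiniteDimensional ℝ X) :
    ∃ x : ℕ → StrongDual ℝ X, IsWeakStarNullUnit x := by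
  obtain ⟨φ, c, hc, hφ, hlim⟩ := hasSeminormalizedNull hX
  refine ⟨fun n => ‖φ n‖⁻¹ • φ n, fun n => ?_, ?_⟩
  · rw [norm_smul, norm_inv, norm_norm, inv_mul_cancel₀ (hc.trans_le (hφ n)).ne']
  · rw [tendsto_iff_forall_eval_tendsto_topDualPairing]
    intro y
    change Tendsto (fun n => ‖φ n‖⁻¹ * φ n y) atTop (𝓝 0)
    refine squeeze_zero_norm (a := fun n => c⁻¹ * |φ n y|) (fun n => ?_) ?_
    · rw [norm_mul, norm_inv, norm_norm, Real.norm_eq_abs]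
      gcongr
      exact hφ n
    · simpa using (hlim y).abs.const_mul c⁻¹

end Null

/-! ### The hull has no farthest point from the origin -/

section Remotal

variable {X : Type*} [NormedAddCommGroup X] [NormedSpace ℝ X]

theorem isCompact_convexJoin {E : Type*} [AddCommGroup E] [Module ℝ E] [TopologicalSpace E]
    [ContinuousAdd E] [ContinuousSMul ℝ E] {A B : Set E} (hA : IsCompact A) (hB : IsCompact B) :
    IsCompact (convexJoin ℝ A B) := by
  have hc : Continuous fun p : (E × E) × ℝ => (1 - p.2) • p.1.1 + p.2 • p.1.2 := by fun_prop
  have himage : convexJoin ℝ A B =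
      (fun p : (E × E) × ℝ => (1 - p.2) • p.1.1 + p.2 • p.1.2) ''
        ((A ×ˢ B) ×ˢ Set.Icc (0 : ℝ) 1) := by
    ext z
    simp only [mem_convexJoin, segment_eq_image]
    constructor
    · rintro ⟨a, ha, b, hb, t, ht, rfl⟩
      exact ⟨((a, b), t), ⟨⟨ha, hb⟩, ht⟩, rfl⟩
    · rintro ⟨⟨⟨a, b⟩, t⟩, ⟨⟨ha, hb⟩, ht⟩, rfl⟩
      exact ⟨a, ha, b, hb, t, ht, rfl⟩
  rw [himage]
  exact ((hA.prod hB).prod isCompact_Icc).image hc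

theorem convex_weakDual_closedBall (r : ℝ) :
    Convex ℝ ((WeakDual.toStrongDual : WeakDual ℝ X ≃ₗ[ℝ] StrongDual ℝ X) ⁻¹'
      Metric.closedBall 0 r) :=
  (convex_closedBall (0 : StrongDual ℝ X) r).linear_preimage
    (WeakDual.toStrongDual : WeakDual ℝ X ≃ₗ[ℝ] StrongDual ℝ X).toLinearMap

theorem closedConvexHull_subset_weakDual_closedBall {S : Set (WeakDual ℝ X)} {r : ℝ}
    (hS : ∀ f ∈ S, ‖WeakDual.toStrongDual f‖ ≤ r) :
    closedConvexHull ℝ S ⊆ WeakDual.toStrongDual ⁻¹' Metric.closedBall 0 r :=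
  closedConvexHull_min (fun f hf => mem_closedBall_zero_iff.2 (hS f hf))
    (convex_weakDual_closedBall r) (WeakDual.isClosed_closedBall 0 r)

theorem isCompact_closedConvexHull_weakDual {S : Set (WeakDual ℝ X)} {r : ℝ}
    (hS : ∀ f ∈ S, ‖WeakDual.toStrongDual f‖ ≤ r) : IsCompact (closedConvexHull ℝ S) :=
  (WeakDual.isCompact_closedBall 0 r).of_isClosed_subset isClosed_closedConvexHull
    (closedConvexHull_subset_weakDual_closedBall hS)

theorem norm_scaled {x : ℕ → StrongDual ℝ X} (hx : ∀ n, ‖x n‖ = 1) (n : ℕ) :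
    ‖((n : ℝ) / ((n : ℝ) + 1)) • x n‖ = (n : ℝ) / ((n : ℝ) + 1) := by
  rw [norm_smul, hx, mul_one, Real.norm_of_nonneg (by positivity)]

theorem natCast_div_add_one_lt_one (n : ℕ) : (n : ℝ) / ((n : ℝ) + 1) < 1 := by
  rw [div_lt_one (by positivity)]
  linarith

theorem natCast_div_add_one_mono {m n : ℕ} (h : m ≤ n) :
    (m : ℝ) / ((m : ℝ) + 1) ≤ (n : ℝ) / ((n : ℝ) + 1) := by
  have : (m : ℝ) ≤ n := by exact_mod_cast h
  rw [div_le_div_iff₀ (by positivity) (by positivity)]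
  nlinarith

theorem norm_le_one_of_mem_scaledSet {x : ℕ → StrongDual ℝ X} (hx : ∀ n, ‖x n‖ = 1) :
    ∀ f ∈ StrongDual.toWeakDual '' scaledSet x, ‖WeakDual.toStrongDual f‖ ≤ 1 := by
  rintro _ ⟨_, ⟨n, -, rfl⟩ | rfl, rfl⟩
  · change ‖((n : ℝ) / ((n : ℝ) + 1)) • x n‖ ≤ 1
    rw [norm_scaled hx]
    exact (natCast_div_add_one_lt_one n).le
  · change ‖(0 : StrongDual ℝ X)‖ ≤ 1
    simp

/-- Norm-one members of the hull already lie in the closed convex hull of every tail. -/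
theorem mem_closedConvexHull_tail {x : ℕ → StrongDual ℝ X} (hx : ∀ n, ‖x n‖ = 1)
    {e : WeakDual ℝ X} (he : e ∈ weakStarClosedConvexHull (scaledSet x))
    (hnorm : 1 ≤ ‖WeakDual.toStrongDual e‖) (N : ℕ) :
    e ∈ closedConvexHull ℝ ((fun n : ℕ =>
      StrongDual.toWeakDual (((n : ℝ) / ((n : ℝ) + 1)) • x n)) '' Set.Ici N) := by
  set r : ℝ := (N : ℝ) / ((N : ℝ) + 1)
  have hr0 : 0 ≤ r := by positivity
  have hr1 : r < 1 := natCast_div_add_one_lt_one N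
  set A : Set (WeakDual ℝ X) := WeakDual.toStrongDual ⁻¹' Metric.closedBall 0 r
  set T : Set (WeakDual ℝ X) := (fun n : ℕ =>
      StrongDual.toWeakDual (((n : ℝ) / ((n : ℝ) + 1)) • x n)) '' Set.Ici N
  have hT : ∀ f ∈ T, ‖WeakDual.toStrongDual f‖ ≤ 1 := by
    rintro _ ⟨n, -, rfl⟩
    exact (norm_scaled hx n).trans_le (natCast_div_add_one_lt_one n).le
  have hA0 : (0 : WeakDual ℝ X) ∈ A := mem_closedBall_zero_iff.2 (by simpa using hr0)
  have hTne : (closedConvexHull ℝ T).Nonempty :=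
    ⟨_, subset_closedConvexHull ⟨N, Set.self_mem_Ici, rfl⟩⟩
  -- The join of two compact convex sets is compact and convex, so no further closure is needed and
  -- each hull element splits as ball part plus tail part.
  have hsub : weakStarClosedConvexHull (scaledSet x) ⊆
      convexJoin ℝ A (closedConvexHull ℝ T) := by
    refine closedConvexHull_min ?_ ((convex_weakDual_closedBall r).convexJoin
      convex_closedConvexHull) (isCompact_convexJoin (WeakDual.isCompact_closedBall 0 r)
        (isCompact_closedConvexHull_weakDual hT)).isClosed
    rintro _ ⟨_, ⟨n, -, rfl⟩ | rfl, rfl⟩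
    · rcases le_total n N with h | h
      · refine subset_convexJoin_left hTne (mem_closedBall_zero_iff.2 ?_)
        exact (norm_scaled hx n).trans_le (natCast_div_add_one_mono h)
      · exact subset_convexJoin_right ⟨0, hA0⟩ (subset_closedConvexHull ⟨n, h, rfl⟩)
    · exact subset_convexJoin_left hTne hA0
  obtain ⟨a, ha, b, hb, p, q, hp, hq, hpq, rfl⟩ := mem_convexJoin.1 (hsub he)
  have ha' : ‖WeakDual.toStrongDual a‖ ≤ r := mem_closedBall_zero_iff.1 ha
  have hb' : ‖WeakDual.toStrongDual b‖ ≤ 1 :=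
    mem_closedBall_zero_iff.1 (closedConvexHull_subset_weakDual_closedBall hT hb)
  have hle : ‖WeakDual.toStrongDual (p • a + q • b)‖ ≤ p * r + q * 1 := by
    rw [map_add, map_smul, map_smul]
    refine (norm_add_le _ _).trans ?_
    rw [norm_smul, norm_smul, Real.norm_of_nonneg hp, Real.norm_of_nonneg hq]
    gcongr
  -- Since `r < 1`, any positive weight on the ball part would force `p * r + q < 1`.
  have hp0 : p = 0 := by
    by_contra hne
    have : 0 < p := lt_of_le_of_ne hp (Ne.symm hne)
    nlinarith
  obtain rfl : q = 1 := by linarith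
  simpa [hp0] using hb

theorem norm_lt_one_of_mem_weakStarClosedConvexHull {x : ℕ → StrongDual ℝ X}
    (hx : IsWeakStarNullUnit x) {e : WeakDual ℝ X}
    (he : e ∈ weakStarClosedConvexHull (scaledSet x)) : ‖WeakDual.toStrongDual e‖ < 1 := by
  by_contra! hnorm
  have hzero : WeakDual.toStrongDual e = 0 := by
    ext z
    refine abs_nonpos_iff.1 (le_of_forall_pos_le_add fun ε hε => ?_)
    have hz : Tendsto (fun n => x n z) atTop (𝓝 0) :=
      ((WeakDual.eval_continuous z).tendsto 0).comp hx.2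
    obtain ⟨N, hN⟩ := Metric.tendsto_atTop.1 hz ε hε
    have hconv : Convex ℝ ((fun f : WeakDual ℝ X => f z) ⁻¹' Metric.closedBall 0 ε) :=
      (convex_closedBall (0 : ℝ) ε).is_linear_preimage ⟨fun _ _ => rfl, fun _ _ => rfl⟩
    have hclosed : IsClosed ((fun f : WeakDual ℝ X => f z) ⁻¹' Metric.closedBall 0 ε) :=
      Metric.isClosed_closedBall.preimage (WeakDual.eval_continuous z)
    have hmem := closedConvexHull_min (s := (fun n : ℕ =>
      StrongDual.toWeakDual (((n : ℝ) / ((n : ℝ) + 1)) • x n)) '' Set.Ici N) (by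
        rintro _ ⟨n, hn, rfl⟩
        refine mem_closedBall_zero_iff.2 ?_
        change ‖(n : ℝ) / ((n : ℝ) + 1) * x n z‖ ≤ ε
        rw [norm_mul, Real.norm_of_nonneg (by positivity)]
        have h1 := hN n hn
        rw [dist_zero_right] at h1
        exact (mul_le_of_le_one_left (norm_nonneg _) (natCast_div_add_one_lt_one n).le).trans h1.le)
      hconv hclosed (mem_closedConvexHull_tail hx.1 he hnorm N)
    rw [zero_add]
    exact mem_closedBall_zero_iff.1 hmem
  rw [hzero, norm_zero] at hnorm
  exact absurd hnorm (by norm_num)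

theorem not_isRemotalFrom_zero_weakStarClosedConvexHull {x : ℕ → StrongDual ℝ X}
    (hx : IsWeakStarNullUnit x) :
    ¬ IsRemotalFrom (WeakDual.toStrongDual '' weakStarClosedConvexHull (scaledSet x)) 0 := by
  rintro ⟨_, ⟨e, he, rfl⟩, hfar⟩
  have hlt := norm_lt_one_of_mem_weakStarClosedConvexHull hx he
  rw [zero_sub, norm_neg] at hfar
  -- The generator of index `n + 1 ≥ 1` has norm at least `1 - 1/(n + 1)`, which exceeds `‖e‖`.
  obtain ⟨n, hn⟩ := exists_nat_one_div_lt (sub_pos.2 hlt)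
  have hbdd : BddAbove ((fun f : StrongDual ℝ X => ‖0 - f‖) ''
      (WeakDual.toStrongDual '' weakStarClosedConvexHull (scaledSet x))) := by
    refine ⟨1, ?_⟩
    rintro _ ⟨_, ⟨f, hf, rfl⟩, rfl⟩
    simpa using (norm_lt_one_of_mem_weakStarClosedConvexHull hx hf).le
  have hmem : StrongDual.toWeakDual ((((n + 1 : ℕ) : ℝ) / (((n + 1 : ℕ) : ℝ) + 1)) • x (n + 1)) ∈
      weakStarClosedConvexHull (scaledSet x) :=
    subset_closedConvexHull ⟨_, Or.inl ⟨n + 1, by omega, rfl⟩, rfl⟩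
  have hle := le_csSup hbdd ⟨_, ⟨_, hmem, rfl⟩, rfl⟩
  change ‖0 - (((n + 1 : ℕ) : ℝ) / (((n + 1 : ℕ) : ℝ) + 1)) • x (n + 1)‖ ≤ farthestDist _ _ at hle
  rw [zero_sub, norm_neg, norm_scaled hx.1, hfar] at hle
  have hfrac : 1 - 1 / ((n : ℝ) + 1) ≤ ((n + 1 : ℕ) : ℝ) / (((n + 1 : ℕ) : ℝ) + 1) := by
    have h1 : ((n + 1 : ℕ) : ℝ) / (((n + 1 : ℕ) : ℝ) + 1) = 1 - 1 / ((n : ℝ) + 1 + 1) := by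
      push_cast
      field_simp
      ring
    rw [h1]
    gcongr
    linarith
  linarith

end Remotal

theorem corollary2 {X : Type*} [NormedAddCommGroup X] [NormedSpace ℝ X] [CompleteSpace X]
    (hX : ¬ FiniteDimensional ℝ X) :
    -- a weak*-compact convex (nonempty, bounded) set that is not remotal exists
    (∃ K : Set (WeakDual ℝ X), K.Nonempty ∧ IsCompact K ∧ Convex ℝ K ∧
      Bornology.IsBounded (WeakDual.toStrongDual '' K) ∧
      ¬ IsRemotal (WeakDual.toStrongDual '' K)) ∧
    -- there are weak*-null sequences of unit vectors, and each of them yields such a set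
    (∃ x : ℕ → StrongDual ℝ X, IsWeakStarNullUnit x) ∧
    (∀ x : ℕ → StrongDual ℝ X, IsWeakStarNullUnit x →
      ∀ K : Set (WeakDual ℝ X), K = weakStarClosedConvexHull (scaledSet x) →
        IsCompact K ∧ Convex ℝ K ∧
        Bornology.IsBounded (WeakDual.toStrongDual '' K) ∧
        ¬ IsRemotalFrom (WeakDual.toStrongDual '' K) 0 ∧
        ¬ IsRemotal (WeakDual.toStrongDual '' K)) := by
  have hmain : ∀ x : ℕ → StrongDual ℝ X, IsWeakStarNullUnit x →
      IsCompact (weakStarClosedConvexHull (scaledSet x)) ∧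
      Convex ℝ (weakStarClosedConvexHull (scaledSet x)) ∧
      Bornology.IsBounded (WeakDual.toStrongDual '' weakStarClosedConvexHull (scaledSet x)) ∧
      ¬ IsRemotalFrom (WeakDual.toStrongDual '' weakStarClosedConvexHull (scaledSet x)) 0 ∧
      ¬ IsRemotal (WeakDual.toStrongDual '' weakStarClosedConvexHull (scaledSet x)) := by
    intro x hx
    have hball := norm_le_one_of_mem_scaledSet hx.1
    refine ⟨isCompact_closedConvexHull_weakDual hball, convex_closedConvexHull,
      Metric.isBounded_closedBall.subset (Set.image_subset_iff.2
        (closedConvexHull_subset_weakDual_closedBall hball)),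
      not_isRemotalFrom_zero_weakStarClosedConvexHull hx,
      fun h => not_isRemotalFrom_zero_weakStarClosedConvexHull hx (h 0)⟩
  obtain ⟨x, hx⟩ := exists_isWeakStarNullUnit hX
  refine ⟨⟨weakStarClosedConvexHull (scaledSet x), ?_⟩, ⟨x, hx⟩, fun x hx K hK => hK ▸ hmain x hx⟩
  obtain ⟨h1, h2, h3, -, h5⟩ := hmain x hx
  exact ⟨⟨0, subset_closedConvexHull ⟨0, Or.inr rfl, map_zero _⟩⟩, h1, h2, h3, h5⟩
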